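/- Let $F$ be an ordered field (for example $F=\mathbb Q$ or $\mathbb R$), let $n\ge 0$, $N=\{1,\dots,n\}$ and $\hat N=\{1,\dots,n+1\}$, and let $\mathbf c=(c_k)_{k\in N}$ be non-negative elements of $F$ (for example non-negative integers). Let $\prec$ be a strict linear order on $N$ such that $i\prec j$ implies $c_i\le c_j$, and write $N=\{s_1\prec s_2\prec\dots\prec s_n\}$. **The polytope $K(\mathbf c)$.** For $k\in N$ write $N_k=\{s_1,\dots,s_k\}=\{t_1<t_2<\dots<t_k\}$ in the natural order. $K(\mathbf c)$ is the set of all $(c'_k)_{k\in N}\in F^n$ such that $0\le c'_k\le c_k$ for all $k\in N$ and $$c'_{t_{i+1}}-c'_{t_i}\ \ge\ \min\{0,\,c_{t_{i+1}}-c_{t_i}\}\qquad (1\le i\le k-1)$$ for every $k\in N$. Let $r^1,\dots,r^{n+1}$ be the coordinate functions on $F^{n+1}$, and identify $(c'_k)_{k\in N}$ with the linear function $\sum_{k\in N}c'_k(r^k-r^{k+1})$. **The graph $\mathscr G(\mathbf c)$.** Its vertices are labelled by $\hat N$ and its edges by $N$. It depends on $n$ and $\prec$ only and is defined by induction on $n$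 (binary fusion). For $n=0$ it is a single vertex with label $1$. For $n\ge1$ let $s$ be the $\prec$-maximal element of $N$, and let $\mathscr G(\mathbf c^-)$ be the graph for $\mathbf c^-=(c_k)_{k\ne s}$ with the restricted order, where $N\setminus\{s\}$ is identified with $\{1,\dots,n-1\}$ by the increasing bijection. Take two copies $\mathscr G^+,\mathscr G^-$ of $\mathscr G(\mathbf c^-)$, with the edge labels read in $N\setminus\{s\}$, and let $\varphi:\mathscr G^+\to\mathscr G^-$ be the identification of the two copies. In $\mathscr G^+$ the vertex labels in $[1,s-1]$ are unchanged and those in $[s,n]$ are increased by $1$. The label of $\varphi(v)$ in $\mathscr G^-$ is that of $v$ in $\mathscr G^+$, except that it is $s$ if $v$ has label $s+1$. Then $\mathscr G(\mathbf c)$ is the union of $\mathscr G^+$ and $\mathscr G^-$ in which, in addition, each vertex $v$ of $\mathscr G^+$ with label $s+1$ is joined to $\varphi(v)$ by an edge with label $s$. **The set $Z(\mathbf c)$.** A pointed chain in $\mathscr G(\mathbf c)$ is a family of vertices $(p_j)_{j\in\hat N}$ such that $p_j$ has label $j$ and, for each $k\in N$, $p_k$ and $p_{k+1}$ are joined by an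 edge with label $k$; there is exactly one. To the vertices $v$ one attaches linear functions $z_v$ on $F^{n+1}$ such that $$z_v-z_{v'}=c_k(r^i-r^j)$$ whenever $v,v'$ have labels $i,j$ and are joined by an edge with label $k$, and $z_{p_{n+1}}=0$. Such functions exist and are unique, and $Z(\mathbf c)=\{z_v : v \text{ a vertex of } \mathscr G(\mathbf c)\}$. **Proposition.** $K(\mathbf c)$ is contained in the convex hull of $Z(\mathbf c)$. -/

import Mathlib

/-- A graph of order `n` with labelled vertices and labelled edges.  The index sets
`{1, …, n + 1}` of vertex labels and `{1, …, n}` of edge labels are `Fin (n + 1)` and `Fin n`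
(the label `k` is the element with value `k - 1`).  `edge k` is the graph formed by the edges
with label `k`. -/
structure LabelledGraph (n : ℕ) where
  V : Type
  label : V → Fin (n + 1)
  edge : Fin n → SimpleGraph V

namespace LabelledGraph

/-- The graph of order `0`: one vertex, with label `1`, and no edge. -/
def point : LabelledGraph 0 where
  V := Unit
  label := fun _ => 0
  edge := fun k => k.elim0

variable {n : ℕ}

/-- The vertex labels of the copy `𝒢⁺` of `𝒢`: the labels in `[1, s - 1]` are unchanged and
those in `[s, n + 1]` are increased by `1`; the label `s` is missed. -/
def plusLabel (G : LabelledGraph n) (s : Fin (n + 1)) (v : G.V) : Fin (n + 2) :=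
  s.castSucc.succAbove (G.label v)

/-- The vertex labels of the copy `𝒢⁻` of `𝒢`: those of `𝒢⁺`, except that the label `s + 1` is
replaced by `s`. -/
def minusLabel (G : LabelledGraph n) (s : Fin (n + 1)) (v : G.V) : Fin (n + 2) :=
  if G.plusLabel s v = s.succ then s.castSucc else G.plusLabel s v

/-- `FusionAdj G s k x y`: the vertices `x` and `y` of the binary fusion are joined by an edge with
label `k`.  `Sum.inl v` is the vertex `v` of `𝒢⁺` and `Sum.inr v` is its image `φ(v)` in `𝒢⁻`.
Inside `𝒢⁺` and `𝒢⁻` the edges are those of `𝒢`, with edge labels in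
`{1, …, n + 1} ∖ {s}` instead of `{1, …, n}`.  In addition each vertex `v` of `𝒢⁺` with
label `s + 1` is joined to `φ(v)` by an edge with label `s`. -/
def FusionAdj (G : LabelledGraph n) (s k : Fin (n + 1)) : G.V ⊕ G.V → G.V ⊕ G.V → Prop
  | Sum.inl v, Sum.inl w => ∃ i, s.succAbove i = k ∧ (G.edge i).Adj v w
  | Sum.inr v, Sum.inr w => ∃ i, s.succAbove i = k ∧ (G.edge i).Adj v w
  | Sum.inl v, Sum.inr w => k = s ∧ v = w ∧ G.plusLabel s v = s.succ
  | Sum.inr w, Sum.inl v => k = s ∧ v = w ∧ G.plusLabel s v = s.succ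

/-- The binary fusion of the two copies `𝒢⁺`, `𝒢⁻` of `𝒢` at `s`. -/
def fusion (G : LabelledGraph n) (s : Fin (n + 1)) : LabelledGraph (n + 1) where
  V := G.V ⊕ G.V
  label := Sum.elim (G.plusLabel s) (G.minusLabel s)
  edge := fun k =>
    { Adj := G.FusionAdj s k
      symm := ⟨by
        rintro (v | v) (w | w) h
        · obtain ⟨i, hi, h⟩ := h
          exact ⟨i, hi, h.symm⟩
        · exact h
        · exact h
        · obtain ⟨i, hi, h⟩ := h
          exact ⟨i, hi, h.symm⟩⟩
      loopless := ⟨by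
        rintro (v | v) ⟨i, -, h⟩
        · exact h.ne rfl
        · exact h.ne rfl⟩ }

/-- The pointed chain: a path with one vertex `p j` of each label `j`, in which the vertices with
labels `k` and `k + 1` are joined by an edge with label `k`. -/
def IsPointedChain (G : LabelledGraph n) (p : Fin (n + 1) → G.V) : Prop :=
  (∀ j, G.label (p j) = j) ∧ ∀ k : Fin n, (G.edge k).Adj (p k.castSucc) (p k.succ)

end LabelledGraph

/-- The maximal element of a non-empty finite index set with respect to a strict linear order. -/
noncomputable def topIndex {n : ℕ} (prec : Fin (n + 1) → Fin (n + 1) → Prop) : Fin (n + 1) :=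
  Classical.epsilon fun s => ∀ i, i ≠ s → prec i s

/-- The canonical `S`-graph, by repeated binary fusion at the maximal element `s` of the
index set; the linear order on the remaining indices is the restriction of the given one. -/
noncomputable def canonicalGraph :
    (n : ℕ) → (Fin n → Fin n → Prop) → LabelledGraph n
  | 0, _ => LabelledGraph.point
  | n + 1, prec =>
    (canonicalGraph n fun i j =>
      prec ((topIndex prec).succAbove i) ((topIndex prec).succAbove j)).fusion (topIndex prec)

/-- The linearly independent linear functions `r¹, …, rⁿ⁺¹` on an `(n + 1)`-dimensional vector
space. -/
def rfun (F : Type*) [Field F] {n : ℕ} (i : Fin (n + 1)) : Module.Dual F (Fin (n + 1) → F) :=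
  LinearMap.proj i

/-- The linear function `∑ c'ₖ (rᵏ - rᵏ⁺¹)` with coordinates `c' = (c'₁, …, c'ₙ)`. -/
def toFunction {F : Type*} [Field F] {n : ℕ} (c' : Fin n → F) : Module.Dual F (Fin (n + 1) → F) :=
  ∑ k, c' k • (rfun F k.castSucc - rfun F k.succ)

/-- `z` evaluates the graph: it attaches to each vertex `v` a linear function `z v` such that
`z v - z w = cₖ (rⁱ - rʲ)` if `v`, `w` have labels `i`, `j` and are joined by an edge
with label `k`, and the driving function, attached to the vertex of the pointed chain that has
label `n + 1`, is zero. -/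
def LabelledGraph.IsEvaluation {F : Type*} [Field F] {n : ℕ} (G : LabelledGraph n) (c : Fin n → F)
    (z : G.V → Module.Dual F (Fin (n + 1) → F)) : Prop :=
  (∃ p, G.IsPointedChain p ∧ z (p (Fin.last n)) = 0) ∧
    ∀ k v w, (G.edge k).Adj v w → z v - z w = c k • (rfun F (G.label v) - rfun F (G.label w))

/-- The set `Z(c)` of the functions `z v`, for `v` a vertex of the canonical `S`-graph. -/
def ZSet {F : Type*} [Field F] {n : ℕ} (prec : Fin n → Fin n → Prop) (c : Fin n → F) :
    Set (Module.Dual F (Fin (n + 1) → F)) :=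
  {f | ∃ z, (canonicalGraph n prec).IsEvaluation c z ∧ ∃ v, z v = f}

/-- The set of all indices up to and including `m` in the order `prec`.  If
`s₁ ≺ s₂ ≺ … ≺ sₙ` are the indices, this is `Nₖ = {s₁, …, sₖ}` for `m = sₖ`. -/
def initialSegment {n : ℕ} (prec : Fin n → Fin n → Prop) (m : Fin n) : Set (Fin n) :=
  {i | prec i m ∨ i = m}

/-- `a < b` are consecutive elements of `S` for the natural order. -/
def ConsecutiveIn {n : ℕ} (S : Set (Fin n)) (a b : Fin n) : Prop :=
  a ∈ S ∧ b ∈ S ∧ a < b ∧ ∀ t ∈ S, ¬ (a < t ∧ t < b)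

/-- The polytope `K(c)`, as a set of coordinate vectors. -/
def KSet {F : Type*} [Field F] [LinearOrder F] {n : ℕ} (prec : Fin n → Fin n → Prop)
    (c : Fin n → F) : Set (Fin n → F) :=
  {c' | (∀ k, 0 ≤ c' k ∧ c' k ≤ c k) ∧
    ∀ m a b, ConsecutiveIn (initialSegment prec m) a b → min 0 (c b - c a) ≤ c' b - c' a}

/-! Induction on `n`, removing the `≺`-maximal index `s`. Put `d = r^s - r^{s+1}` and `c_{n+1} = 0`.
An evaluation of the smaller graph extends to the fusion: relabel it on `𝒢⁺`, and on `𝒢⁻` relabel it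
and add `(c_s - c_{s+1}) d`. The joining edges come out right because of a stronger invariant: at a
vertex with label `i` the coefficient of `rⁱ` is `cᵢ` (`isNormalEvaluation_fusionEval`).

Let `a ∈ K(c)`. Dropping `a_s` gives a point of the smaller polytope, hence by induction a point `f`
of the smaller hull. Its images `u` and `w` under the two extensions lie in the hulls of the two
copies. With `a_0 = a_{n+1} = 0`, the function of `a` equals `u + (a_s - a_{s-1}) d` and also `w -
(a_{s+1} - a_s + c_s - c_{s+1}) d`. Both coefficients are non-negative by the inequalities of `K(c)`
around `s`, since `c_s` is maximal; so the function of `a` lies on the segment from `u` to `w`. -/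

namespace LabelledGraph

/-! ### Labels and the pointed chain of a fusion -/

variable {n : ℕ}

theorem minusLabel_eq (G : LabelledGraph n) (s : Fin (n + 1)) (v : G.V) :
    G.minusLabel s v = s.succ.succAbove (G.label v) := by
  unfold minusLabel plusLabel
  generalize G.label v = l
  simp only [Fin.succAbove, Fin.ext_iff, Fin.lt_def]
  split_ifs <;> simp_all <;> omega

theorem plusLabel_eq_succ_iff (G : LabelledGraph n) (s : Fin (n + 1)) (v : G.V) :
    G.plusLabel s v = s.succ ↔ G.label v = s := by
  unfold plusLabel
  generalize G.label v = l
  simp only [Fin.succAbove, Fin.ext_iff, Fin.lt_def]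
  split_ifs <;> simp_all
  omega

/-- The pointed chain of the fusion obtained from a pointed chain `q`. -/
def fusionChain (G : LabelledGraph n) (s : Fin (n + 1)) (q : Fin (n + 1) → G.V)
    (j : Fin (n + 2)) : G.V ⊕ G.V :=
  if j ≤ s.castSucc then Sum.inr (q (s.predAbove j)) else Sum.inl (q (s.predAbove j))

/-- The chain runs through `𝒢⁻` up to label `s` and through `𝒢⁺` from `s + 1` on, crossing at the
vertex of `q` with label `s`, which is used in both copies. -/
theorem isPointedChain_fusionChain (G : LabelledGraph n) (s : Fin (n + 1))
    (q : Fin (n + 1) → G.V) (hq : G.IsPointedChain q) :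
    (G.fusion s).IsPointedChain (G.fusionChain s q) := by
  obtain ⟨hl, he⟩ := hq
  constructor
  · intro j
    unfold fusionChain
    split_ifs with h
    · change G.minusLabel s _ = j
      rw [minusLabel_eq, hl]
      exact Fin.succ_succAbove_predAbove (by rintro rfl; simp [Fin.le_def] at h)
    · change G.plusLabel s _ = j
      rw [plusLabel, hl]
      exact Fin.succAbove_predAbove (by rintro rfl; simp at h)
  · intro k
    change G.FusionAdj s k _ _
    unfold fusionChain
    rcases Fin.eq_self_or_eq_succAbove s k with rfl | ⟨i, rfl⟩
    · have h1 : k.castSucc ≤ k.castSucc := le_rfl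
      have h2 : ¬ k.succ ≤ k.castSucc := by simp [Fin.le_def]
      simp only [h1, h2, if_true, if_false]
      refine ⟨rfl, ?_, ?_⟩
      · simp
      · simp [plusLabel_eq_succ_iff, hl]
    · rcases lt_or_ge i.castSucc s with h | h
      · rw [Fin.succAbove_of_castSucc_lt _ _ h]
        have h1 : i.castSucc.castSucc ≤ s.castSucc := by simpa using h.le
        have h2 : i.castSucc.succ ≤ s.castSucc := by
          simp only [Fin.le_def, Fin.lt_def, Fin.val_succ, Fin.val_castSucc] at h ⊢; omega
        simp only [h1, h2, if_true]
        refine ⟨i, Fin.succAbove_of_castSucc_lt _ _ h, ?_⟩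
        convert he i using 2
        · exact Fin.predAbove_castSucc_of_le _ _ h.le
        · rw [Fin.succ_castSucc] at h2 ⊢
          exact Fin.predAbove_castSucc_of_le _ _ (by
            simp only [Fin.le_def, Fin.lt_def, Fin.val_succ, Fin.val_castSucc] at h ⊢; omega)
      · rw [Fin.succAbove_of_le_castSucc _ _ h]
        have h1 : ¬ i.succ.castSucc ≤ s.castSucc := by
          simp only [Fin.le_def, Fin.val_succ, Fin.val_castSucc] at h ⊢; omega
        have h2 : ¬ i.succ.succ ≤ s.castSucc := by
          simp only [Fin.le_def, Fin.val_succ, Fin.val_castSucc] at h ⊢; omega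
        simp only [h1, h2, if_false]
        refine ⟨i, Fin.succAbove_of_le_castSucc _ _ h, ?_⟩
        convert he i using 2
        · rw [← Fin.succ_castSucc]
          exact Fin.predAbove_succ_of_le _ _ h
        · exact Fin.predAbove_succ_of_le _ _ (h.trans (Fin.castSucc_lt_succ).le)

end LabelledGraph

/-! ### Evaluations of a fusion, and coordinates under relabelling -/

section Evaluation

variable {F : Type*} [Field F] {n : ℕ}

/-- Substitution `rⁱ ↦ r^{g i}` on linear functions. -/
def relabel (g : Fin (n + 1) → Fin (n + 2)) :
    Module.Dual F (Fin (n + 1) → F) →ₗ[F] Module.Dual F (Fin (n + 2) → F) :=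
  (LinearMap.funLeft F F g).dualMap

@[simp]
theorem relabel_apply (g : Fin (n + 1) → Fin (n + 2)) (f : Module.Dual F (Fin (n + 1) → F))
    (x : Fin (n + 2) → F) : relabel g f x = f (x ∘ g) := rfl

@[simp]
theorem rfun_apply (i : Fin (n + 1)) (x : Fin (n + 1) → F) : rfun F i x = x i := rfl

theorem toFunction_apply (a : Fin n → F) (x : Fin (n + 1) → F) :
    toFunction a x = ∑ k, a k * (x k.castSucc - x k.succ) := by
  simp [toFunction, LinearMap.sum_apply]

theorem single_comp_of_injective {g : Fin (n + 1) → Fin (n + 2)} (hg : g.Injective)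
    (i : Fin (n + 1)) : (Pi.single (g i) 1 : Fin (n + 2) → F) ∘ g = Pi.single i 1 := by
  funext j
  simp [Pi.single_apply, hg.eq_iff]

/-- The two substitutions differ only in the image of `r^s`, which is `r^{s+1}` or `r^s`. -/
theorem relabel_plus_sub_relabel_minus (s : Fin (n + 1)) (f : Module.Dual F (Fin (n + 1) → F)) :
    relabel s.castSucc.succAbove f - relabel s.succ.succAbove f =
      f (Pi.single s 1) • (rfun F s.succ - rfun F s.castSucc) := by
  refine LinearMap.ext fun x => ?_
  have : x ∘ s.castSucc.succAbove - x ∘ s.succ.succAbove =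
      (x s.succ - x s.castSucc) • Pi.single s 1 := by
    funext j
    rcases eq_or_ne j s with rfl | hj
    · simp
    · rcases lt_or_gt_of_ne hj with h | h
      · have h1 : s.castSucc.succAbove j = j.castSucc :=
          Fin.succAbove_of_castSucc_lt _ _ (by simpa using h)
        have h2 : s.succ.succAbove j = j.castSucc :=
          Fin.succAbove_of_castSucc_lt _ _ (by simpa [Fin.lt_def] using Nat.lt_succ_of_lt h)
        simp [h1, h2, hj]
      · have h1 : s.castSucc.succAbove j = j.succ :=
          Fin.succAbove_of_le_castSucc _ _ (by simpa using h.le)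
        have h2 : s.succ.succAbove j = j.succ :=
          Fin.succAbove_of_le_castSucc _ _ (by simpa [Fin.le_def] using Nat.succ_le_of_lt h)
        simp [h1, h2, hj]
  have h := congrArg f this
  rw [map_sub, map_smul] at h
  simp only [LinearMap.sub_apply, relabel_apply, h, LinearMap.smul_apply, rfun_apply, smul_eq_mul]
  ring

/-- The evaluation of the fusion obtained from an evaluation `z`. -/
def fusionEval (G : LabelledGraph n) (s : Fin (n + 1)) (c : Fin (n + 1) → F)
    (z : G.V → Module.Dual F (Fin (n + 1) → F)) :
    G.V ⊕ G.V → Module.Dual F (Fin (n + 2) → F) :=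
  Sum.elim (fun v => relabel s.castSucc.succAbove (z v))
    (fun v => relabel s.succ.succAbove (z v) +
      (c s - (Fin.snoc (c ∘ s.succAbove) 0 : Fin (n + 1) → F) s) •
        (rfun F s.castSucc - rfun F s.succ))

theorem snoc_castSucc_succAbove (c : Fin (n + 1) → F) (s l : Fin (n + 1)) :
    (Fin.snoc c 0 : Fin (n + 2) → F) (s.castSucc.succAbove l) =
      (Fin.snoc (c ∘ s.succAbove) 0 : Fin (n + 1) → F) l := by
  induction l using Fin.lastCases with
  | last =>
    rw [Fin.succAbove_of_le_castSucc _ _ (by simp [Fin.le_def]; omega), Fin.succ_last]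
    simp
  | cast i =>
    rw [Fin.castSucc_succAbove_castSucc]
    simp

/-- An evaluation with respect to which the coefficient of `rⁱ` at each vertex with label `i` is
`cᵢ`, where `c_{n+1} = 0`. -/
def IsNormalEvaluation (G : LabelledGraph n) (c : Fin n → F)
    (z : G.V → Module.Dual F (Fin (n + 1) → F)) : Prop :=
  G.IsEvaluation c z ∧
    ∀ v, z v (Pi.single (G.label v) 1) = (Fin.snoc c 0 : Fin (n + 1) → F) (G.label v)

/-- On a joining edge the relabelled functions differ by `-c_{s+1} d`, by normality of `z`; the
shift on `𝒢⁻` turns this into the required `-c_s d`. -/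
theorem isNormalEvaluation_fusionEval (G : LabelledGraph n) (s : Fin (n + 1))
    (c : Fin (n + 1) → F) (z : G.V → Module.Dual F (Fin (n + 1) → F))
    (h : IsNormalEvaluation G (c ∘ s.succAbove) z) :
    IsNormalEvaluation (G.fusion s) c (fusionEval G s c z) := by
  obtain ⟨⟨⟨q, hq, hq0⟩, he⟩, hn⟩ := h
  have hjoin : ∀ v, G.plusLabel s v = s.succ →
      fusionEval G s c z (Sum.inl v) - fusionEval G s c z (Sum.inr v) =
        c s • (rfun F (G.plusLabel s v) - rfun F (G.minusLabel s v)) := by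
    intro v hv
    have hm : G.minusLabel s v = s.castSucc := by simp [LabelledGraph.minusLabel, hv]
    have hl := (G.plusLabel_eq_succ_iff s v).1 hv
    have h1 := relabel_plus_sub_relabel_minus s (z v)
    have h2 := hn v
    rw [hl] at h2
    rw [h2] at h1
    rw [hv, hm]
    simp only [fusionEval, Sum.elim_inl, Sum.elim_inr]
    rw [← sub_sub, h1]
    module
  refine ⟨⟨⟨_, G.isPointedChain_fusionChain s q hq, ?_⟩, ?_⟩, ?_⟩
  -- The last vertex of the chain lies in `𝒢⁺`, where no shift is added, so its function stays zero.
  · have h1 : ¬ Fin.last (n + 1) ≤ s.castSucc := by simp [Fin.le_def]; omega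
    have h2 : s.predAbove (Fin.last (n + 1)) = Fin.last n := by simp
    simp only [LabelledGraph.fusionChain, h1, if_false, h2, fusionEval, Sum.elim_inl, hq0, map_zero]
  · rintro k (v | v) (w | w) hk
    · obtain ⟨i, rfl, hi⟩ := hk
      change relabel _ (z v) - relabel _ (z w) = _
      rw [← map_sub, he i v w hi, map_smul, map_sub]
      rfl
    · obtain ⟨rfl, rfl, hv⟩ := hk
      exact hjoin v hv
    · obtain ⟨rfl, rfl, hv⟩ := hk
      change fusionEval G k c z (Sum.inr w) - fusionEval G k c z (Sum.inl w) =
        c k • (rfun F (G.minusLabel k w) - rfun F (G.plusLabel k w))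
      rw [← neg_sub, hjoin w hv]
      module
    · obtain ⟨i, rfl, hi⟩ := hk
      change (relabel _ (z v) + _) - (relabel _ (z w) + _) =
        _ • (rfun F (G.minusLabel s v) - rfun F (G.minusLabel s w))
      rw [add_sub_add_right_eq_sub, ← map_sub, he i v w hi, map_smul, map_sub,
        G.minusLabel_eq, G.minusLabel_eq]
      rfl
  · rintro (v | v)
    · change relabel _ (z v) (Pi.single (G.plusLabel s v) 1) =
        (Fin.snoc c 0 : Fin (n + 2) → F) (G.plusLabel s v)
      rw [LabelledGraph.plusLabel, snoc_castSucc_succAbove, relabel_apply,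
        single_comp_of_injective Fin.succAbove_right_injective, hn]
    · change (relabel _ (z v) + _ • (rfun F s.castSucc - rfun F s.succ))
          (Pi.single (G.minusLabel s v) 1) =
        (Fin.snoc c 0 : Fin (n + 2) → F) (G.minusLabel s v)
      have h1 : relabel s.succ.succAbove (z v) (Pi.single (G.minusLabel s v) 1) =
          (Fin.snoc (c ∘ s.succAbove) 0 : Fin (n + 1) → F) (G.label v) := by
        rw [G.minusLabel_eq, relabel_apply,
          single_comp_of_injective Fin.succAbove_right_injective, hn]
      rw [LinearMap.add_apply, h1]
      by_cases hv : G.plusLabel s v = s.succ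
      · have hm : G.minusLabel s v = s.castSucc := by simp [LabelledGraph.minusLabel, hv]
        have hne : s.succ ≠ s.castSucc := by simp [Fin.ext_iff]
        rw [(G.plusLabel_eq_succ_iff s v).1 hv, hm]
        simp [hne]
      · have hm : G.minusLabel s v = G.plusLabel s v := by simp [LabelledGraph.minusLabel, hv]
        have h3 : s.castSucc ≠ G.plusLabel s v := (Fin.succAbove_ne _ _).symm
        rw [hm]
        simp only [LinearMap.smul_apply, LinearMap.sub_apply, rfun_apply, Pi.single_apply, h3,
          Ne.symm hv, if_false, sub_zero, smul_zero, add_zero]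
        exact (snoc_castSucc_succAbove c s _).symm

theorem sum_ite_succ_eq (a : Fin n → F) (s : Fin (n + 1)) (d : F) :
    (∑ i, if i.succ = s then a i * d else 0) = (Fin.cons 0 a : Fin (n + 1) → F) s * d := by
  induction s using Fin.cases with
  | zero => simp [Fin.succ_ne_zero]
  | succ t => simp

theorem sum_ite_castSucc_eq (a : Fin n → F) (s : Fin (n + 1)) (d : F) :
    (∑ i, if i.castSucc = s then a i * d else 0) = (Fin.snoc a 0 : Fin (n + 1) → F) s * d := by
  induction s using Fin.lastCases with
  | last => simp [Fin.castSucc_ne_last]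
  | cast t => simp

/-- Relabelling sends the basis function of edge `s - 1` to `r^{s-1} - r^{s+1} = (r^{s-1} - r^s) +
d` and fixes the others. The entry `0` of `Fin.cons` covers `s = 1`. -/
theorem toFunction_eq_relabel_plus (a : Fin (n + 1) → F) (s : Fin (n + 1)) :
    toFunction a = relabel s.castSucc.succAbove (toFunction (a ∘ s.succAbove)) +
      (a s - (Fin.cons 0 (a ∘ s.succAbove) : Fin (n + 1) → F) s) •
        (rfun F s.castSucc - rfun F s.succ) := by
  refine LinearMap.ext fun x => ?_
  have key : ∀ i : Fin n, a (s.succAbove i) *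
        (x (s.castSucc.succAbove i.castSucc) - x (s.castSucc.succAbove i.succ)) =
      a (s.succAbove i) * (x (s.succAbove i).castSucc - x (s.succAbove i).succ) +
        if i.succ = s then (a ∘ s.succAbove) i * (x s.castSucc - x s.succ) else 0 := by
    intro i
    rw [Fin.castSucc_succAbove_castSucc]
    split_ifs with h
    · subst h
      have h1 : i.succ.succAbove i = i.castSucc := by simp
      simp only [Fin.succAbove_castSucc_self, h1, Function.comp, Fin.succ_castSucc]
      ring
    · have : s.castSucc.succAbove i.succ = (s.succAbove i).succ := by
        simp only [Fin.succAbove, Fin.ext_iff, Fin.lt_def] at h ⊢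
        split_ifs <;> simp_all <;> omega
      rw [this, add_zero]
  simp only [LinearMap.add_apply, relabel_apply, toFunction_apply, Function.comp_apply,
    LinearMap.smul_apply, LinearMap.sub_apply, rfun_apply, smul_eq_mul]
  rw [Finset.sum_congr rfl fun i _ => key i, Finset.sum_add_distrib, sum_ite_succ_eq,
    Fin.sum_univ_succAbove _ s]
  ring

/-- Here it is edge `s + 1` whose function acquires an extra `d`, becoming `r^s - r^{s+2}`; the `0`
of `Fin.snoc` covers the last index. -/
theorem toFunction_eq_relabel_minus (a : Fin (n + 1) → F) (s : Fin (n + 1)) :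
    toFunction a = relabel s.succ.succAbove (toFunction (a ∘ s.succAbove)) +
      (a s - (Fin.snoc (a ∘ s.succAbove) 0 : Fin (n + 1) → F) s) •
        (rfun F s.castSucc - rfun F s.succ) := by
  refine LinearMap.ext fun x => ?_
  have key : ∀ i : Fin n, a (s.succAbove i) *
        (x (s.succ.succAbove i.castSucc) - x (s.succ.succAbove i.succ)) =
      a (s.succAbove i) * (x (s.succAbove i).castSucc - x (s.succAbove i).succ) +
        if i.castSucc = s then (a ∘ s.succAbove) i * (x s.castSucc - x s.succ) else 0 := by
    intro i
    rw [Fin.succ_succAbove_succ]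
    split_ifs with h
    · subst h
      have h1 : i.succ.castSucc.succAbove i.castSucc = i.castSucc.castSucc := by
        rw [← Fin.succ_castSucc]; simp
      simp only [Fin.succAbove_castSucc_self, Function.comp, Fin.succ_castSucc, h1]
      ring
    · have : s.succ.succAbove i.castSucc = (s.succAbove i).castSucc := by
        simp only [Fin.succAbove, Fin.ext_iff, Fin.lt_def] at h ⊢
        split_ifs <;> simp_all <;> omega
      rw [this, add_zero]
  simp only [LinearMap.add_apply, relabel_apply, toFunction_apply, Function.comp_apply,
    LinearMap.smul_apply, LinearMap.sub_apply, rfun_apply, smul_eq_mul]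
  rw [Finset.sum_congr rfl fun i _ => key i, Finset.sum_add_distrib, sum_ite_castSucc_eq,
    Fin.sum_univ_succAbove _ s]
  ring

end Evaluation

/-! ### The maximal index and restriction of the polytope -/

theorem topIndex_spec {n : ℕ} (prec : Fin (n + 1) → Fin (n + 1) → Prop)
    (h : IsStrictTotalOrder (Fin (n + 1)) prec) (i : Fin (n + 1)) (hi : i ≠ topIndex prec) :
    prec i (topIndex prec) := by
  have hwf : WellFounded (Function.swap prec) := Finite.wellFounded_of_trans_of_irrefl _
  obtain ⟨m, -, hm⟩ := hwf.has_min Set.univ Set.univ_nonempty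
  refine Classical.epsilon_spec (p := fun s => ∀ i, i ≠ s → prec i s) ⟨m, fun j hj => ?_⟩ i hi
  rcases trichotomous_of prec j m with h | h | h
  · exact h
  · exact absurd h hj
  · exact absurd h (hm j trivial)

theorem initialSegment_topIndex {n : ℕ} (prec : Fin (n + 1) → Fin (n + 1) → Prop)
    (hprec : IsStrictTotalOrder (Fin (n + 1)) prec) :
    initialSegment prec (topIndex prec) = Set.univ := by
  ext i
  by_cases h : i = topIndex prec
  · simp [initialSegment, h]
  · simp [initialSegment, topIndex_spec prec hprec i h]

/-- An initial segment ending at an index other than the maximal one omits the maximal one, so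
consecutive pairs in it are the same before and after deletion. -/
theorem comp_succAbove_mem_KSet {F : Type*} [Field F] [LinearOrder F] {n : ℕ} (prec : Fin (n + 1) → Fin (n + 1) → Prop)
    (hprec : IsStrictTotalOrder (Fin (n + 1)) prec) (c a : Fin (n + 1) → F)
    (ha : a ∈ KSet prec c) :
    a ∘ (topIndex prec).succAbove ∈
      KSet (fun i j => prec ((topIndex prec).succAbove i) ((topIndex prec).succAbove j))
        (c ∘ (topIndex prec).succAbove) := by
  have htop := topIndex_spec prec hprec
  set s := topIndex prec
  refine ⟨fun k => ha.1 _, fun m x y ⟨hx, hy, hxy, ht⟩ => ha.2 (s.succAbove m) _ _ ?_⟩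
  have hmem : ∀ i, i ∈ initialSegment (fun i j => prec (s.succAbove i) (s.succAbove j)) m ↔
      s.succAbove i ∈ initialSegment prec (s.succAbove m) := by
    intro i
    simp [initialSegment]
  refine ⟨(hmem x).1 hx, (hmem y).1 hy, Fin.succAbove_lt_succAbove_iff.2 hxy, fun t htm => ?_⟩
  rcases Fin.eq_self_or_eq_succAbove s t with rfl | ⟨i, rfl⟩
  · rcases htm with h | h
    · exact absurd h (asymm_of prec (htop _ (Fin.succAbove_ne _ _)))
    · exact absurd h.symm (Fin.succAbove_ne _ _)
  · simpa using ht i ((hmem i).2 htm)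

/-! ### The segment argument and the induction -/

section Polytope

variable {F : Type*} [Field F] [LinearOrder F] [IsStrictOrderedRing F] {n : ℕ}

/-- The point divides the segment from `u` to `w` in the ratio `α : β`. -/
theorem add_smul_mem_of_add_smul_eq_sub_smul {E : Type*} [AddCommGroup E] [Module F E] {S : Set E}
    (hS : Convex F S) {u w d : E} {α β : F} (hu : u ∈ S) (hw : w ∈ S) (hα : 0 ≤ α) (hβ : 0 ≤ β)
    (h : u + α • d = w - β • d) : u + α • d ∈ S := by
  rcases (add_nonneg hα hβ).eq_or_lt with h0 | h0
  -- If `α + β = 0`, the ratio is undefined, but the point is `u`.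
  · have : α = 0 := by linarith
    simpa [this] using hu
  · have h1 : w = u + (α + β) • d := by
      rw [add_smul, ← add_assoc, h, sub_add_cancel]
    have h2 := hS hu hw (div_nonneg hβ h0.le) (div_nonneg hα h0.le)
      (by field_simp; ring)
    convert h2 using 1
    have hα' : α = α / (α + β) * (α + β) := by field_simp
    have hb : β / (α + β) = 1 - α / (α + β) := by field_simp; ring
    rw [h1, hb]
    nth_rewrite 1 [hα']
    module

/-- In the full index set `s - 1` and `s` are consecutive, and the minimum is `0` as `c_s` is
maximal; at the first index this is `0 ≤ a_s`. -/
theorem cons_le_of_mem_KSet (prec : Fin (n + 1) → Fin (n + 1) → Prop)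
    (hprec : IsStrictTotalOrder (Fin (n + 1)) prec) (c a : Fin (n + 1) → F)
    (hc : ∀ i j, prec i j → c i ≤ c j) (ha : a ∈ KSet prec c) :
    (Fin.cons 0 (a ∘ (topIndex prec).succAbove) : Fin (n + 1) → F) (topIndex prec) ≤
      a (topIndex prec) := by
  have htop := topIndex_spec prec hprec
  have huniv := initialSegment_topIndex prec hprec
  generalize topIndex prec = s at *
  induction s using Fin.cases with
  | zero => exact (ha.1 _).1
  | succ t =>
    have h := ha.2 t.succ t.castSucc t.succ ?_
    · rw [min_eq_left (sub_nonneg.2 (hc _ _ (htop _ (Fin.castSucc_lt_succ).ne)))] at h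
      simpa using h
    · rw [huniv]
      refine ⟨trivial, trivial, Fin.castSucc_lt_succ, fun u _ => ?_⟩
      simp only [Fin.lt_def, Fin.val_castSucc, Fin.val_succ]
      omega

/-- For the pair `s`, `s + 1` the minimum is `c_{s+1} - c_s`; at the last index the bound is `a_s ≤
c_s`. -/
theorem le_snoc_of_mem_KSet (prec : Fin (n + 1) → Fin (n + 1) → Prop)
    (hprec : IsStrictTotalOrder (Fin (n + 1)) prec) (c a : Fin (n + 1) → F)
    (hc : ∀ i j, prec i j → c i ≤ c j) (ha : a ∈ KSet prec c) :
    a (topIndex prec) +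
        (Fin.snoc (c ∘ (topIndex prec).succAbove) 0 : Fin (n + 1) → F) (topIndex prec) ≤
      (Fin.snoc (a ∘ (topIndex prec).succAbove) 0 : Fin (n + 1) → F) (topIndex prec) +
        c (topIndex prec) := by
  have htop := topIndex_spec prec hprec
  have huniv := initialSegment_topIndex prec hprec
  generalize topIndex prec = s at *
  induction s using Fin.lastCases with
  | last => simpa using (ha.1 _).2
  | cast t =>
    have h := ha.2 t.castSucc t.castSucc t.succ ?_
    · rw [min_eq_right (sub_nonpos.2 (hc _ _ (htop _ (Fin.castSucc_lt_succ).ne')))] at h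
      simp only [Fin.snoc_castSucc, Function.comp_apply, Fin.succAbove_castSucc_self]
      linarith
    · rw [huniv]
      refine ⟨trivial, trivial, Fin.castSucc_lt_succ, fun u _ => ?_⟩
      simp only [Fin.lt_def, Fin.val_castSucc, Fin.val_succ]
      omega

theorem toFunction_mem_convexHull_range_fusionEval (G : LabelledGraph n) (s : Fin (n + 1))
    (c a : Fin (n + 1) → F) (z : G.V → Module.Dual F (Fin (n + 1) → F))
    (hf : toFunction (a ∘ s.succAbove) ∈ convexHull F (Set.range z))
    (hα : (Fin.cons 0 (a ∘ s.succAbove) : Fin (n + 1) → F) s ≤ a s)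
    (hβ : a s + (Fin.snoc (c ∘ s.succAbove) 0 : Fin (n + 1) → F) s ≤
      (Fin.snoc (a ∘ s.succAbove) 0 : Fin (n + 1) → F) s + c s) :
    toFunction a ∈ convexHull F (Set.range (fusionEval G s c z)) := by
  set S := convexHull F (Set.range (fusionEval G s c z))
  have hS : Convex F S := convex_convexHull F _
  have hu : relabel s.castSucc.succAbove (toFunction (a ∘ s.succAbove)) ∈ S := by
    refine convexHull_min ?_ (hS.linear_preimage (relabel s.castSucc.succAbove)) hf
    rintro _ ⟨v, rfl⟩
    exact subset_convexHull F _ ⟨Sum.inl v, rfl⟩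
  have hw : relabel s.succ.succAbove (toFunction (a ∘ s.succAbove)) +
      (c s - (Fin.snoc (c ∘ s.succAbove) 0 : Fin (n + 1) → F) s) •
        (rfun F s.castSucc - rfun F s.succ) ∈ S := by
    refine convexHull_min ?_
      ((hS.translate_preimage_left _).linear_preimage (relabel s.succ.succAbove)) hf
    rintro _ ⟨v, rfl⟩
    exact subset_convexHull F _ ⟨Sum.inr v, rfl⟩
  rw [toFunction_eq_relabel_plus a s]
  refine add_smul_mem_of_add_smul_eq_sub_smul hS hu hw (sub_nonneg.2 hα) (sub_nonneg.2 hβ) ?_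
  rw [← toFunction_eq_relabel_plus a s, toFunction_eq_relabel_minus a s]
  module

theorem exists_isNormalEvaluation_KSet_subset (n : ℕ) (prec : Fin n → Fin n → Prop)
    (hprec : IsStrictTotalOrder (Fin n) prec) (c : Fin n → F)
    (hc : ∀ i j, prec i j → c i ≤ c j) :
    ∃ z, IsNormalEvaluation (canonicalGraph n prec) c z ∧
      toFunction '' KSet prec c ⊆ convexHull F (Set.range z) := by
  induction n with
  | zero =>
    refine ⟨fun _ => 0, ⟨⟨⟨fun _ => (), ⟨fun j => (Fin.fin_one_eq_zero j).symm,
      fun k => k.elim0⟩, rfl⟩, fun k => k.elim0⟩, fun v => ?_⟩, ?_⟩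
    -- The only label is `n + 1`, where normality prescribes the coefficient `0`.
    · change (0 : F) = (Fin.snoc c 0 : Fin 1 → F) (Fin.last 0)
      rw [Fin.snoc_last]
    · rintro _ ⟨a, -, rfl⟩
      refine subset_convexHull F _ ⟨(), ?_⟩
      simp [toFunction]
  | succ n ih =>
    obtain ⟨z, hz, hK⟩ := ih
      (fun i j => prec ((topIndex prec).succAbove i) ((topIndex prec).succAbove j))
      (RelEmbedding.isStrictTotalOrder
        (⟨(topIndex prec).succAboveEmb, Iff.rfl⟩ : RelEmbedding _ prec))
      (c ∘ (topIndex prec).succAbove) (fun i j h => hc _ _ h)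
    refine ⟨fusionEval _ (topIndex prec) c z, isNormalEvaluation_fusionEval _ _ c z hz, ?_⟩
    rintro _ ⟨a, ha, rfl⟩
    have hf := hK ⟨_, comp_succAbove_mem_KSet prec hprec c a ha, rfl⟩
    exact toFunction_mem_convexHull_range_fusionEval _ _ c a z hf
      (cons_le_of_mem_KSet prec hprec c a hc ha) (le_snoc_of_mem_KSet prec hprec c a hc ha)

end Polytope

theorem proposition3p5 {F : Type*} [Field F] [LinearOrder F] [IsStrictOrderedRing F]
    (n : ℕ) (prec : Fin n → Fin n → Prop) (hprec : IsStrictTotalOrder (Fin n) prec)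
    (c : Fin n → F) (hc0 : ∀ k, 0 ≤ c k) (hc : ∀ i j, prec i j → c i ≤ c j) :
    toFunction '' KSet prec c ⊆ convexHull F (ZSet prec c) := by
  obtain ⟨z, hz, h⟩ := exists_isNormalEvaluation_KSet_subset n prec hprec c hc
  refine h.trans (convexHull_mono ?_)
  rintro _ ⟨v, rfl⟩
  exact ⟨z, hz.1, v, rfl⟩
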